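/- Let $M$ be a (Hausdorff) smooth manifold and $E\to M$ a smooth real vector bundle of finite rank. The gauge Lie algebroid $\mathfrak{D}E$ has as fibre at $m\in M$ the space of pairs $(\mathfrak d,x)$, where $x\in T_mM$ and $\mathfrak d:\Gamma(E)\to E_m$ is $\mathbb R$-linear with $\mathfrak d(fu)=f(m)\,\mathfrak d(u)+x(f)\,u(m)$ for all $f\in C^\infty(M)$, $u\in\Gamma(E)$ ($x$ is determined by $\mathfrak d$ if $E_m\neq0$); the anchor is $\alpha(\mathfrak d,x)=x$, and $\mathfrak{gl}(E_m)\subset(\mathfrak DE)_m$ by $\Phi\mapsto(u\mapsto\Phi(u(m)),0)$. $\Gamma(\mathfrak DE)$ consists of the families $\mathfrak d=(\mathfrak d_m)_m$ that map smooth sections of $E$ to smooth sections and have smooth anchor; its bracket $[\cdot,\cdot]_{\mathfrak D}$ is the commutator of operators on $\Gamma(E)$, with anchor the Lie bracket of the anchors. The (first) jet bundle $\mathfrak JE$ has as fibre at $m$ the space of linear maps $\mu:(\mathfrak DE)_m\to E_m$ with $\mu(\Phi)=\Phi(\mu(\mathbf 1_{E_m}))$ for all $\Phi\in\mathfrak{gl}(E_m)$;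 $\Gamma(\mathfrak JE)$ consists of the families $\mu$ for which $\langle\mu,\mathfrak d\rangle_E:=\mu(\mathfrak d)$ is a smooth section of $E$ for every $\mathfrak d\in\Gamma(\mathfrak DE)$. For $u\in\Gamma(E)$ let $\mathbb d u\in\Gamma(\mathfrak JE)$ be given by $\langle\mathbb d u,\mathfrak d\rangle_E=\mathfrak d(u)$. Then for $\mathfrak d\in\Gamma(\mathfrak DE)$ and $\mu\in\Gamma(\mathfrak JE)$ there is a unique $\mathfrak L_{\mathfrak d}\mu\in\Gamma(\mathfrak JE)$ with $$\langle\mathfrak L_{\mathfrak d}\mu,\mathfrak r\rangle_E=\mathfrak d\langle\mu,\mathfrak r\rangle_E-\langle\mu,[\mathfrak d,\mathfrak r]_{\mathfrak D}\rangle_E\qquad\text{for all }\mathfrak r\in\Gamma(\mathfrak DE).$$ Let $\mathcal E=\mathfrak DE\oplus\mathfrak JE$, let $\rho:\mathcal E\to\mathfrak DE$ be the projection, and for $\mathfrak d,\mathfrak r\in\Gamma(\mathfrak DE)$, $\mu,\nu\in\Gamma(\mathfrak JE)$ put $$(\mathfrak d+\mu,\mathfrak r+\nu)_E=\tfrac12\big(\langle\nu,\mathfrak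 d\rangle_E+\langle\mu,\mathfrak r\rangle_E\big),\qquad \{\mathfrak d+\mu,\mathfrak r+\nu\}=[\mathfrak d,\mathfrak r]_{\mathfrak D}+\mathfrak L_{\mathfrak d}\nu-\mathfrak L_{\mathfrak r}\mu+\mathbb d\langle\mu,\mathfrak r\rangle_E .$$ Then for all $X,Y,Z\in\Gamma(\mathcal E)$ and $f\in C^\infty(M)$: 1. $(\Gamma(\mathcal E),\{\cdot,\cdot\})$ is a Leibniz algebra, i.e. $\{\cdot,\cdot\}$ is $\mathbb R$-bilinear and $\{X,\{Y,Z\}\}=\{\{X,Y\},Z\}+\{Y,\{X,Z\}\}$; 2. $\rho\{X,Y\}=[\rho(X),\rho(Y)]_{\mathfrak D}$; 3. $\{X,fY\}=f\{X,Y\}+\big((\alpha\circ\rho(X))(f)\big)Y$; 4. $\{X,X\}=\mathbb d\,(X,X)_E$; 5. $\rho(X)(Y,Z)_E=(\{X,Y\},Z)_E+(Y,\{X,Z\})_E$. -/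

import Mathlib

open Bundle VectorField Filter
open scoped Manifold ContDiff Topology

namespace OmniLie

section

variable {EM : Type*} [NormedAddCommGroup EM] [NormedSpace ℝ EM]
  {M : Type*} [TopologicalSpace M] [ChartedSpace EM M] [IsManifold 𝓘(ℝ, EM) ∞ M]

/-- The derivative of a smooth function along a smooth vector field is smooth. -/
theorem contMDiff_mvfderiv_apply (f : C^∞⟮𝓘(ℝ, EM), M; ℝ⟯)
    {X : ∀ m : M, TangentSpace 𝓘(ℝ, EM) m}
    (hX : ContMDiff 𝓘(ℝ, EM) 𝓘(ℝ, EM).tangent ∞ (fun m => (⟨m, X m⟩ : TangentBundle 𝓘(ℝ, EM) M))) :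
    ContMDiff 𝓘(ℝ, EM) 𝓘(ℝ, ℝ) ∞ (fun m => mvfderiv 𝓘(ℝ, EM) f m (X m)) := by
  have h := (f.contMDiff.contMDiff_tangentMap (m := ∞) (by simp)).comp hX
  exact (contMDiff_snd_tangentBundle_modelSpace ℝ 𝓘(ℝ, ℝ)).comp h

/-- `[X, Y](f) = X(Y(f)) - Y(X(f))`. -/
theorem mvfderiv_mlieBracket [FiniteDimensional ℝ EM] (f : C^∞⟮𝓘(ℝ, EM), M; ℝ⟯)
    {X Y : ∀ m : M, TangentSpace 𝓘(ℝ, EM) m}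
    (hX : ContMDiff 𝓘(ℝ, EM) 𝓘(ℝ, EM).tangent ∞ (fun m => (⟨m, X m⟩ : TangentBundle 𝓘(ℝ, EM) M)))
    (hY : ContMDiff 𝓘(ℝ, EM) 𝓘(ℝ, EM).tangent ∞ (fun m => (⟨m, Y m⟩ : TangentBundle 𝓘(ℝ, EM) M)))
    (m : M) :
    mvfderiv 𝓘(ℝ, EM) f m (mlieBracket 𝓘(ℝ, EM) X Y m) =
      mvfderiv 𝓘(ℝ, EM) (fun p => mvfderiv 𝓘(ℝ, EM) f p (Y p)) m (X m) -
        mvfderiv 𝓘(ℝ, EM) (fun p => mvfderiv 𝓘(ℝ, EM) f p (X p)) m (Y m) := by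
  have := FiniteDimensional.complete ℝ EM
  rcases subsingleton_or_nontrivial EM with hE | hE
  · have h0 : ∀ v : TangentSpace 𝓘(ℝ, EM) m, v = 0 := fun v => Subsingleton.elim (α := EM) _ _
    rw [h0 (mlieBracket 𝓘(ℝ, EM) X Y m), h0 (X m), h0 (Y m)]
    simp
  obtain ⟨v, hv⟩ := exists_ne (0 : EM)
  let v' : TangentSpace 𝓘(ℝ, EM) m := v
  let Z : ∀ p : M, TangentSpace 𝓘(ℝ, EM) p := FiberBundle.extend EM v'
  have h3 : (minSmoothness ℝ 3) ≤ (∞ : ℕ∞ω) := by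
    rw [minSmoothness_of_isRCLikeNormedField]; exact WithTop.coe_le_coe.2 (le_top : (3 : ℕ∞) ≤ ⊤)
  have h2 : (minSmoothness ℝ 2) ≤ (∞ : ℕ∞ω) := by
    rw [minSmoothness_of_isRCLikeNormedField]; exact WithTop.coe_le_coe.2 (le_top : (2 : ℕ∞) ≤ ⊤)
  have : IsManifold 𝓘(ℝ, EM) (minSmoothness ℝ 3) M := IsManifold.of_le h3
  have : IsManifold 𝓘(ℝ, EM) (((⊤ : ℕ∞) : ℕ∞ω) + 1) M := by simpa
  obtain ⟨s, hs, hZs⟩ := FiberBundle.exists_contMDiffOn_extend (I := 𝓘(ℝ, EM)) (k := ∞) EM v'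
  have hZn : ∀ᶠ p in 𝓝 m, ContMDiffAt 𝓘(ℝ, EM) 𝓘(ℝ, EM).tangent ∞
      (fun m => (⟨m, Z m⟩ : TangentBundle 𝓘(ℝ, EM) M)) p := by
    filter_upwards [eventually_mem_nhds_iff.2 hs] with p hp
    exact hZs.contMDiffAt hp
  have hZ := hZn.self_of_nhds
  have hZv : Z m ≠ 0 := by
    have : Z m = v' := FiberBundle.extend_apply_self EM v'
    rw [this]; exact hv
  have hb : ∀ {U W : ∀ p : M, TangentSpace 𝓘(ℝ, EM) p} {p : M},
      ContMDiffAt 𝓘(ℝ, EM) 𝓘(ℝ, EM).tangent ∞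
        (fun m => (⟨m, U m⟩ : TangentBundle 𝓘(ℝ, EM) M)) p →
      ContMDiffAt 𝓘(ℝ, EM) 𝓘(ℝ, EM).tangent ∞
        (fun m => (⟨m, W m⟩ : TangentBundle 𝓘(ℝ, EM) M)) p →
      ContMDiffAt 𝓘(ℝ, EM) 𝓘(ℝ, EM).tangent ∞
        (fun m => (⟨m, mlieBracket 𝓘(ℝ, EM) U W m⟩ : TangentBundle 𝓘(ℝ, EM) M)) p := by
    intro U W p hU hW
    exact ContMDiffAt.mlieBracket_vectorField (m := ⊤) (n := ⊤) hU hW (by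
      rw [minSmoothness_of_isRCLikeNormedField]; simp)
  have hf : ∀ p, MDifferentiableAt 𝓘(ℝ, EM) 𝓘(ℝ, ℝ) f p := fun p => f.mdifferentiableAt
  have hd : ∀ {U : ∀ p : M, TangentSpace 𝓘(ℝ, EM) p} {p : M},
      ContMDiffAt 𝓘(ℝ, EM) 𝓘(ℝ, EM).tangent ∞
        (fun m => (⟨m, U m⟩ : TangentBundle 𝓘(ℝ, EM) M)) p →
      MDifferentiableAt 𝓘(ℝ, EM) 𝓘(ℝ, EM).tangent
        (fun m => (⟨m, U m⟩ : TangentBundle 𝓘(ℝ, EM) M)) p :=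
    fun h => h.mdifferentiableAt (by simp)
  have key : ∀ {U W : ∀ p : M, TangentSpace 𝓘(ℝ, EM) p},
      ContMDiff 𝓘(ℝ, EM) 𝓘(ℝ, EM).tangent ∞
        (fun m => (⟨m, U m⟩ : TangentBundle 𝓘(ℝ, EM) M)) →
      ContMDiff 𝓘(ℝ, EM) 𝓘(ℝ, EM).tangent ∞
        (fun m => (⟨m, W m⟩ : TangentBundle 𝓘(ℝ, EM) M)) →
      mlieBracket 𝓘(ℝ, EM) U (mlieBracket 𝓘(ℝ, EM) W ((f : M → ℝ) • Z)) m =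
        mvfderiv 𝓘(ℝ, EM) (fun p => mvfderiv 𝓘(ℝ, EM) f p (W p)) m (U m) • Z m
        + mvfderiv 𝓘(ℝ, EM) f m (W m) • mlieBracket 𝓘(ℝ, EM) U Z m
        + (mvfderiv 𝓘(ℝ, EM) f m (U m) • mlieBracket 𝓘(ℝ, EM) W Z m
        + f m • mlieBracket 𝓘(ℝ, EM) U (mlieBracket 𝓘(ℝ, EM) W Z) m) := by
    intro U W hU hW
    have hg := contMDiff_mvfderiv_apply f hW
    have hgd : MDifferentiableAt 𝓘(ℝ, EM) 𝓘(ℝ, ℝ) (fun p => mvfderiv 𝓘(ℝ, EM) f p (W p)) m :=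
      (hg m).mdifferentiableAt (by simp)
    have e : mlieBracket 𝓘(ℝ, EM) W ((f : M → ℝ) • Z) =ᶠ[𝓝 m]
        (fun p => mvfderiv 𝓘(ℝ, EM) f p (W p)) • Z +
          (f : M → ℝ) • mlieBracket 𝓘(ℝ, EM) W Z := by
      filter_upwards [hZn] with p hp
      exact mlieBracket_smul_right (hf p) (hd hp)
    rw [EventuallyEq.mlieBracket_vectorField_eq (EventuallyEq.refl _ U) e,
      mlieBracket_add_right (hd ((hg m).smul_section hZ))
        (hd ((f.contMDiff m).smul_section (hb (hW m) hZ))),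
      mlieBracket_smul_right hgd (hd hZ), mlieBracket_smul_right (hf m) (hd (hb (hW m) hZ))]
  have jac := leibniz_identity_mlieBracket_apply (U := X) (V := Y) (W := (f : M → ℝ) • Z)
    ((hX m).of_le h2) ((hY m).of_le h2) (((f.contMDiff m).smul_section hZ).of_le h2)
  have jac' := leibniz_identity_mlieBracket_apply (U := X) (V := Y) (W := Z)
    ((hX m).of_le h2) ((hY m).of_le h2) (hZ.of_le h2)
  rw [key hX hY, key hY hX, mlieBracket_smul_right (hf m) (hd hZ), jac'] at jac
  refine smul_left_injective ℝ hZv ?_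
  simp only [sub_smul]
  rw [smul_add] at jac
  rw [← sub_eq_zero] at jac ⊢
  rw [← neg_eq_zero, ← jac]
  module
end

/-- The axioms of a (left) Leibniz algebra over `ℝ` for a bracket on a vector space. -/
structure IsLeibnizAlgebra {L : Type*} [AddCommGroup L] [Module ℝ L] (br : L → L → L) : Prop where
  add_left : ∀ X Y Z, br (X + Y) Z = br X Z + br Y Z
  smul_left : ∀ (c : ℝ) X Y, br (c • X) Y = c • br X Y
  add_right : ∀ X Y Z, br X (Y + Z) = br X Y + br X Z
  smul_right : ∀ (c : ℝ) X Y, br X (c • Y) = c • br X Y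
  leibniz : ∀ X Y Z, br X (br Y Z) = br (br X Y) Z + br Y (br X Z)

noncomputable section

variable {EM : Type*} [NormedAddCommGroup EM] [NormedSpace ℝ EM]
  {M : Type*} [TopologicalSpace M] [ChartedSpace EM M]
  {F : Type*} [NormedAddCommGroup F] [NormedSpace ℝ F]
  {V : M → Type*} [TopologicalSpace (TotalSpace F V)]
  [∀ m, AddCommGroup (V m)] [∀ m, Module ℝ (V m)] [∀ m, TopologicalSpace (V m)]
  [FiberBundle F V] [VectorBundle ℝ F V]

/-- Multiplication of a smooth section of the bundle by a smooth function. -/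
instance : SMul C^∞⟮𝓘(ℝ, EM), M; ℝ⟯ Cₛ^∞⟮𝓘(ℝ, EM); F, V⟯ :=
  ⟨fun f u => ⟨fun m => f m • u m, f.contMDiff.smul_section u.contMDiff⟩⟩

theorem smul_sec_apply (f : C^∞⟮𝓘(ℝ, EM), M; ℝ⟯) (u : Cₛ^∞⟮𝓘(ℝ, EM); F, V⟯) (m : M) :
    (f • u) m = f m • u m := rfl

variable (EM F V) in
/-- The fibre at `m` of the gauge Lie algebroid (bundle of covariant differential operators):
`ℝ`-linear operators `Γ(E) → E_m` together with an anchor `x ∈ T_m M` such that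
`𝔡(fu) = f(m) 𝔡(u) + x(f) u(m)`. The anchor is recorded as part of the data; it is determined by
the operator as soon as `E_m ≠ 0`. -/
def GaugeFiber (m : M) :
    Submodule ℝ ((Cₛ^∞⟮𝓘(ℝ, EM); F, V⟯ →ₗ[ℝ] V m) × TangentSpace 𝓘(ℝ, EM) m) where
  carrier := {δ | ∀ (f : C^∞⟮𝓘(ℝ, EM), M; ℝ⟯) (u : Cₛ^∞⟮𝓘(ℝ, EM); F, V⟯),
    δ.1 (f • u) = f m • δ.1 u + mvfderiv 𝓘(ℝ, EM) f m δ.2 • u m}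
  zero_mem' f u := by simp
  add_mem' {a b} ha hb f u := by
    simp only [Set.mem_ofPred_eq] at ha hb
    simp only [Prod.fst_add, Prod.snd_add, LinearMap.add_apply, map_add, ha, hb]
    module
  smul_mem' c a ha f u := by
    simp only [Set.mem_ofPred_eq] at ha
    simp only [Prod.smul_fst, Prod.smul_snd, LinearMap.smul_apply, map_smul, ha, smul_eq_mul]
    module

/-- The operator `Γ(E) → E_m` underlying an element of the gauge algebroid. -/
def gaugeOp {m : M} (δ : GaugeFiber EM F V m) : Cₛ^∞⟮𝓘(ℝ, EM); F, V⟯ →ₗ[ℝ] V m := δ.1.1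

/-- The anchor `α : 𝔇E → TM`. -/
def gaugeAnchor {m : M} (δ : GaugeFiber EM F V m) : TangentSpace 𝓘(ℝ, EM) m := δ.1.2

variable (EM F) in
/-- The embedding `gl(E_m) → (𝔇E)_m`, with `Φ` acting by `u ↦ Φ (u(m))` and zero anchor. -/
def gaugeOfEnd {m : M} (Φ : V m →ₗ[ℝ] V m) : GaugeFiber EM F V m :=
  ⟨({ toFun := fun u => Φ (u m)
      map_add' := fun u v => by simp
      map_smul' := fun c u => by simp }, 0),
    fun f u => by simp [smul_sec_apply]⟩

variable (EM F V) in
/-- The fibre at `m` of the (first) jet bundle `𝔍E`, as the standard `E`-dual of `𝔇E`: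
linear maps `ν : (𝔇E)_m → E_m` such that `ν(Φ) = Φ(ν(1))` for all `Φ ∈ gl(E_m)`. -/
def JetFiber (m : M) : Submodule ℝ (GaugeFiber EM F V m →ₗ[ℝ] V m) where
  carrier := {ν | ∀ Φ : V m →ₗ[ℝ] V m,
    ν (gaugeOfEnd EM F Φ) = Φ (ν (gaugeOfEnd EM F LinearMap.id))}
  zero_mem' Φ := by simp
  add_mem' {a b} ha hb Φ := by
    simp only [Set.mem_ofPred_eq] at ha hb
    simp only [LinearMap.add_apply, map_add, ha Φ, hb Φ]
  smul_mem' c a ha Φ := by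
    simp only [Set.mem_ofPred_eq] at ha
    simp only [LinearMap.smul_apply, map_smul, ha Φ]

variable [IsManifold 𝓘(ℝ, EM) ∞ M]

variable (EM F V) in
/-- `Γ(𝔇E)`: a section of the gauge algebroid is smooth when it maps smooth sections of `E` to
smooth sections of `E` and its anchor is a smooth vector field; so `Γ(𝔇E)` is the space of
covariant differential operators on `Γ(E)`. -/
def GaugeSec : Submodule ℝ (∀ m : M, GaugeFiber EM F V m) where
  carrier := {d |
    (∀ u : Cₛ^∞⟮𝓘(ℝ, EM); F, V⟯, ContMDiff 𝓘(ℝ, EM) (𝓘(ℝ, EM).prod 𝓘(ℝ, F)) ∞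
      (fun m => TotalSpace.mk' F m (gaugeOp (d m) u))) ∧
    ContMDiff 𝓘(ℝ, EM) 𝓘(ℝ, EM).tangent ∞
      (fun m => (⟨m, gaugeAnchor (d m)⟩ : TangentBundle 𝓘(ℝ, EM) M))}
  zero_mem' := ⟨fun _ => (0 : Cₛ^∞⟮𝓘(ℝ, EM); F, V⟯).contMDiff,
    (0 : Cₛ^∞⟮𝓘(ℝ, EM); EM, (TangentSpace 𝓘(ℝ, EM) : M → Type _)⟯).contMDiff⟩
  add_mem' ha hb := ⟨fun u => (ha.1 u).add_section (hb.1 u), ha.2.add_section hb.2⟩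
  smul_mem' _ _ ha := ⟨fun u => (ha.1 u).const_smul_section, ha.2.const_smul_section⟩

variable (EM F V) in
/-- `Γ(𝔍E)`: a section of `𝔍E ⊂ Hom(𝔇E, E)` is smooth when it maps smooth sections of `𝔇E` to
smooth sections of `E`. -/
def JetSec : Submodule ℝ (∀ m : M, JetFiber EM F V m) where
  carrier := {μ | ∀ d : GaugeSec EM F V, ContMDiff 𝓘(ℝ, EM) (𝓘(ℝ, EM).prod 𝓘(ℝ, F)) ∞
      (fun m => TotalSpace.mk' F m ((μ m).1 (d.1 m)))}
  zero_mem' _ := (0 : Cₛ^∞⟮𝓘(ℝ, EM); F, V⟯).contMDiff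
  add_mem' ha hb d := (ha d).add_section (hb d)
  smul_mem' _ _ ha d := (ha d).const_smul_section

/-- Multiplication of sections of `𝔇E` by smooth functions. -/
instance : SMul C^∞⟮𝓘(ℝ, EM), M; ℝ⟯ (GaugeSec EM F V) :=
  ⟨fun f d => ⟨fun m => f m • d.1 m,
    fun u => f.contMDiff.smul_section (d.2.1 u), f.contMDiff.smul_section d.2.2⟩⟩

/-- Multiplication of sections of `𝔍E` by smooth functions. -/
instance : SMul C^∞⟮𝓘(ℝ, EM), M; ℝ⟯ (JetSec EM F V) :=
  ⟨fun f μ => ⟨fun m => f m • μ.1 m, fun d => f.contMDiff.smul_section (μ.2 d)⟩⟩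

/-- The action of `Γ(𝔇E)` on `Γ(E)`. -/
def act (d : GaugeSec EM F V) (u : Cₛ^∞⟮𝓘(ℝ, EM); F, V⟯) : Cₛ^∞⟮𝓘(ℝ, EM); F, V⟯ :=
  ⟨fun m => gaugeOp (d.1 m) u, d.2.1 u⟩

/-- The derivative `α(d)(f)` of a smooth function along the anchor of `d ∈ Γ(𝔇E)`. -/
def anchorDeriv (d : GaugeSec EM F V) (f : C^∞⟮𝓘(ℝ, EM), M; ℝ⟯) : C^∞⟮𝓘(ℝ, EM), M; ℝ⟯ :=
  ⟨fun m => mvfderiv 𝓘(ℝ, EM) f m (gaugeAnchor (d.1 m)), contMDiff_mvfderiv_apply f d.2.2⟩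

theorem act_smul (d : GaugeSec EM F V) (f : C^∞⟮𝓘(ℝ, EM), M; ℝ⟯)
    (u : Cₛ^∞⟮𝓘(ℝ, EM); F, V⟯) : act d (f • u) = f • act d u + anchorDeriv d f • u := by
  ext m
  exact (d.1 m).2 f u

/-- The bracket `[d, r]_𝔇` on `Γ(𝔇E)`: the commutator of the operators on `Γ(E)`, whose anchor is
the Lie bracket of the anchors. -/
def gaugeBracket [FiniteDimensional ℝ EM] (d r : GaugeSec EM F V) : GaugeSec EM F V :=
  ⟨fun m => ⟨(gaugeOp (d.1 m) ∘ₗ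
        { toFun := act r
          map_add' := fun u v => by ext p; exact map_add (gaugeOp (r.1 p)) u v
          map_smul' := fun c u => by ext p; exact map_smul (gaugeOp (r.1 p)) c u } -
      gaugeOp (r.1 m) ∘ₗ
        { toFun := act d
          map_add' := fun u v => by ext p; exact map_add (gaugeOp (d.1 p)) u v
          map_smul' := fun c u => by ext p; exact map_smul (gaugeOp (d.1 p)) c u },
      mlieBracket 𝓘(ℝ, EM) (fun p => gaugeAnchor (d.1 p)) (fun p => gaugeAnchor (r.1 p)) m), by
    intro f u
    have h1 : gaugeOp (d.1 m) (f • act r u) = _ := (d.1 m).2 f (act r u)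
    have h2 : gaugeOp (d.1 m) (anchorDeriv r f • u) = _ := (d.1 m).2 (anchorDeriv r f) u
    have h3 : gaugeOp (r.1 m) (f • act d u) = _ := (r.1 m).2 f (act d u)
    have h4 : gaugeOp (r.1 m) (anchorDeriv d f • u) = _ := (r.1 m).2 (anchorDeriv d f) u
    simp only [LinearMap.sub_apply, LinearMap.comp_apply, LinearMap.coe_mk, AddHom.coe_mk,
      act_smul, map_add, mvfderiv_mlieBracket f d.2.2 r.2.2 m, h1, h2, h3, h4]
    change _ = f m • (gaugeOp (d.1 m) (act r u) - gaugeOp (r.1 m) (act d u)) +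
      (mvfderiv 𝓘(ℝ, EM) (anchorDeriv r f) m (gaugeAnchor (d.1 m)) -
        mvfderiv 𝓘(ℝ, EM) (anchorDeriv d f) m (gaugeAnchor (r.1 m))) • u m
    change (f m • gaugeOp (d.1 m) (act r u) +
        mvfderiv 𝓘(ℝ, EM) f m (gaugeAnchor (d.1 m)) • gaugeOp (r.1 m) u +
        (mvfderiv 𝓘(ℝ, EM) f m (gaugeAnchor (r.1 m)) • gaugeOp (d.1 m) u +
          mvfderiv 𝓘(ℝ, EM) (anchorDeriv r f) m (gaugeAnchor (d.1 m)) • u m)) -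
      (f m • gaugeOp (r.1 m) (act d u) +
        mvfderiv 𝓘(ℝ, EM) f m (gaugeAnchor (r.1 m)) • gaugeOp (d.1 m) u +
        (mvfderiv 𝓘(ℝ, EM) f m (gaugeAnchor (d.1 m)) • gaugeOp (r.1 m) u +
          mvfderiv 𝓘(ℝ, EM) (anchorDeriv d f) m (gaugeAnchor (r.1 m)) • u m)) = _
    module⟩,
  fun u => (act d (act r u) - act r (act d u)).contMDiff, by
    have := FiniteDimensional.complete ℝ EM
    have : IsManifold 𝓘(ℝ, EM) (((⊤ : ℕ∞) : ℕ∞ω) + 1) M := by simpa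
    have : IsManifold 𝓘(ℝ, EM) (minSmoothness ℝ 2) M := IsManifold.of_le (n := ∞) (by
      rw [minSmoothness_of_isRCLikeNormedField]
      exact WithTop.coe_le_coe.2 (le_top : (2 : ℕ∞) ≤ ⊤))
    exact ContDiff.mlieBracket_vectorField (m := ⊤) (n := ⊤) d.2.2 r.2.2 (by
      rw [minSmoothness_of_isRCLikeNormedField]; simp)⟩

/-- The `E`-valued pairing `⟨μ, d⟩_E` of sections. -/
def pairing (μ : JetSec EM F V) (d : GaugeSec EM F V) : Cₛ^∞⟮𝓘(ℝ, EM); F, V⟯ :=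
  ⟨fun m => (μ.1 m).1 (d.1 m), μ.2 d⟩

/-- The differential `𝕕 : Γ(E) → Γ(𝔍E)`, `(𝕕u)(𝔡) = 𝔡(u)`, that is, `𝕕u = [u]` is the jet
prolongation of `u`. -/
def jetD (u : Cₛ^∞⟮𝓘(ℝ, EM); F, V⟯) : JetSec EM F V :=
  ⟨fun _ => ⟨{ toFun := fun δ => gaugeOp δ u
               map_add' := fun _ _ => rfl
               map_smul' := fun _ _ => rfl }, fun _ => rfl⟩,
    fun d => d.2.1 u⟩

/-- The Leibniz rule characterizing the Lie derivative `ν = 𝔏_d μ`: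
`⟨ν, r⟩ = d⟨μ, r⟩ - ⟨μ, [d, r]⟩` for all `r ∈ Γ(𝔇E)`. -/
def IsLieDerivative [FiniteDimensional ℝ EM] (d : GaugeSec EM F V) (μ ν : JetSec EM F V) : Prop :=
  ∀ r : GaugeSec EM F V, pairing ν r = act d (pairing μ r) - pairing μ (gaugeBracket d r)

open Classical in
/-- The Lie derivative `𝔏_d μ ∈ Γ(𝔍E)`: the section characterized by `IsLieDerivative d μ`.
It always exists and is unique on a vector bundle of finite rank over a manifold; the theorem
asserts this together with the properties of the bracket. -/
def lieDerivative [FiniteDimensional ℝ EM] (d : GaugeSec EM F V) (μ : JetSec EM F V) : JetSec EM F V :=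
  if h : ∃ ν, IsLieDerivative d μ ν then h.choose else 0

variable (EM F V) in
/-- `Γ(𝓔)` for `𝓔 = 𝔇E ⊕ 𝔍E`. -/
abbrev OmniSec := GaugeSec EM F V × JetSec EM F V

/-- The projection `ρ : Γ(𝓔) → Γ(𝔇E)`. -/
def rho (X : OmniSec EM F V) : GaugeSec EM F V := X.1

/-- The symmetric `E`-valued pairing `(d + μ, r + ν)_E = ½ (⟨d, ν⟩_E + ⟨r, μ⟩_E)`. -/
def omniPairing (X Y : OmniSec EM F V) : Cₛ^∞⟮𝓘(ℝ, EM); F, V⟯ :=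
  (1 / 2 : ℝ) • (pairing Y.2 X.1 + pairing X.2 Y.1)

/-- The Dorfman bracket `{d + μ, r + ν} = [d, r]_𝔇 + 𝔏_d ν - 𝔏_r μ + 𝕕⟨μ, r⟩_E`. -/
def dorfman [FiniteDimensional ℝ EM] (X Y : OmniSec EM F V) : OmniSec EM F V :=
  (gaugeBracket X.1 Y.1,
    lieDerivative X.1 Y.2 - lieDerivative Y.1 X.2 + jetD (pairing X.2 Y.1))

end

end OmniLie

/-!
Frames of `E` and `TM` near a point, cut off by a bump function, give finitely many global sections
with smooth coordinates. A fibre element of `𝔇E` splits, after cutting off, into endomorphisms of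
the fibre and a lift of its anchor along the flat connection of the frame, so `Γ(𝔇E)` has cut off
frames as well. Hence every fibre element extends to a global section, and a `C^∞(M)`-linear map
`Γ(𝔇E) → Γ(E)` is induced by fibre maps; applied to `r ↦ d⟨μ, r⟩ - ⟨μ, [d, r]⟩`, this yields
`𝔏_d μ`. A section of `𝔍E` is determined by its pairings with all `s ∈ Γ(𝔇E)`, and the identities
for the Dorfman bracket, paired with `s`, are consequences of `[d, r] = d r - r d` and of the Jacobi
and Leibniz rules for `[·, ·]_𝔇`.
-/

namespace OmniLie

noncomputable section

variable {EM : Type*} [NormedAddCommGroup EM] [NormedSpace ℝ EM]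
  {M : Type*} [TopologicalSpace M] [ChartedSpace EM M]

section DirectionalDerivative

variable {p : M}

/-- The directional derivative `x(f)` of a smooth function `f` along a tangent vector `x`. -/
def dirDeriv : TangentSpace 𝓘(ℝ, EM) p →ₗ[ℝ] C^∞⟮𝓘(ℝ, EM), M; ℝ⟯ →ₗ[ℝ] ℝ :=
  LinearMap.mk₂ ℝ (fun x f => mvfderiv 𝓘(ℝ, EM) f p x) (fun _ _ _ => map_add _ _ _)
    (fun _ _ _ => map_smul _ _ _)
    (fun x f g => by
      rw [ContMDiffMap.coe_add, mvfderiv_add f.mdifferentiableAt g.mdifferentiableAt]; rfl)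
    (fun c x f => by
      change mvfderiv 𝓘(ℝ, EM) (fun q => c * f q) p x = _
      rw [mvfderiv_fun_mul mdifferentiableAt_const f.mdifferentiableAt, mvfderiv_const]
      simp)

theorem dirDeriv_mul (x : TangentSpace 𝓘(ℝ, EM) p) (f g : C^∞⟮𝓘(ℝ, EM), M; ℝ⟯) :
    dirDeriv x (f * g) = f p * dirDeriv x g + g p * dirDeriv x f := by
  change mvfderiv 𝓘(ℝ, EM) (f * g : M → ℝ) p x = _
  rw [mvfderiv_mul f.mdifferentiableAt g.mdifferentiableAt]
  rfl

end DirectionalDerivative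

section CutoffFrame

variable (EM) in
/-- Evaluation of smooth functions at a point. -/
abbrev evalAt (p : M) : C^∞⟮𝓘(ℝ, EM), M; ℝ⟯ →+* ℝ := ContMDiffMap.evalRingHom p

variable {W : M → Type*} [∀ p, AddCommMonoid (W p)] [∀ p, Module ℝ (W p)]
  {Γ : Type*} [AddCommMonoid Γ] [Module C^∞⟮𝓘(ℝ, EM), M; ℝ⟯ Γ]

/-- Let `Γ` be a `C^∞(M)`-module of sections of a family of vector spaces `W p`, with evaluation
maps `ev p : Γ → W p`. A cutoff frame at `m` consists of finitely many sections and smooth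
coordinate functionals for which `∑ i, coord i w • sec i = cut • w`, where `cut` is a smooth
function with value `1` at `m`: a local frame and its dual frame, both cut off. -/
structure CutoffFrame (ev : ∀ p : M, Γ →ₛₗ[evalAt EM p] W p) (m : M) where
  ι : Type
  [fintype : Fintype ι]
  sec : ι → Γ
  coord : ι → ∀ p, W p →ₗ[ℝ] ℝ
  contMDiff_coord : ∀ i s, ContMDiff 𝓘(ℝ, EM) 𝓘(ℝ, ℝ) ∞ fun p => coord i p (ev p s)
  cut : C^∞⟮𝓘(ℝ, EM), M; ℝ⟯
  cut_self : cut m = 1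
  sum_coord_smul_sec : ∀ p w, ∑ i, coord i p w • ev p (sec i) = cut p • w

namespace CutoffFrame

attribute [instance] CutoffFrame.fintype

variable {ev : ∀ p : M, Γ →ₛₗ[evalAt EM p] W p} {m : M} (S : CutoffFrame ev m)

/-- The coordinate functions of a section in a cutoff frame. -/
def coeff (i : S.ι) : Γ →ₗ[C^∞⟮𝓘(ℝ, EM), M; ℝ⟯] C^∞⟮𝓘(ℝ, EM), M; ℝ⟯ where
  toFun s := ⟨fun p => S.coord i p (ev p s), S.contMDiff_coord i s⟩
  map_add' s t := by
    ext p
    change S.coord i p (ev p (s + t)) = S.coord i p (ev p s) + S.coord i p (ev p t)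
    rw [map_add, map_add]
  map_smul' f s := by
    ext p
    change S.coord i p (ev p (f • s)) = f p • S.coord i p (ev p s)
    rw [map_smulₛₗ, map_smul]
    rfl

theorem sum_coord_smul_map {W' : Type*} [AddCommMonoid W'] [Module ℝ W'] {p : M}
    (L : W p →ₗ[ℝ] W') (w : W p) :
    ∑ i, S.coord i p w • L (ev p (S.sec i)) = S.cut p • L w := by
  rw [← map_smul, ← S.sum_coord_smul_sec, map_sum]
  simp only [map_smul]

theorem sum_coord_self (w : W m) : ∑ i, S.coord i m w • ev m (S.sec i) = w := by
  rw [S.sum_coord_smul_sec, S.cut_self, one_smul]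

theorem sum_coeff_smul_sec (hev : Function.Injective fun s p => ev p s) (s : Γ) :
    ∑ i, S.coeff i s • S.sec i = S.cut • s := by
  refine hev (funext fun p => ?_)
  simp only [map_sum, map_smulₛₗ]
  exact S.sum_coord_smul_sec p (ev p s)

include S in
theorem eval_surjective : Function.Surjective (ev m) := fun w => by
  let c (i : S.ι) : C^∞⟮𝓘(ℝ, EM), M; ℝ⟯ := .const (S.coord i m w)
  refine ⟨∑ i, c i • S.sec i, ?_⟩
  simp only [map_sum, map_smulₛₗ]
  exact S.sum_coord_self w

include S in
theorem exists_eq_comp_eval (hev : Function.Injective fun s p => ev p s)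
    {W' : Type*} [AddCommMonoid W'] [Module ℝ W'] (ℓ : Γ →ₛₗ[evalAt EM m] W') :
    ∃ ν : W m →ₗ[ℝ] W', ∀ s, ℓ s = ν (ev m s) := by
  refine ⟨∑ i, (S.coord i m).smulRight (ℓ (S.sec i)), fun s => ?_⟩
  have hcut : evalAt EM m S.cut = 1 := S.cut_self
  calc ℓ s = ℓ (S.cut • s) := by rw [map_smulₛₗ, hcut, one_smul]
    _ = ∑ i, S.coord i m (ev m s) • ℓ (S.sec i) := by
      rw [← S.sum_coeff_smul_sec hev, map_sum]
      simp only [map_smulₛₗ]; rfl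
    _ = _ := by simp only [LinearMap.sum_apply, LinearMap.smulRight_apply]

end CutoffFrame

end CutoffFrame

variable {F : Type*} [NormedAddCommGroup F] [NormedSpace ℝ F]
  {V : M → Type*} [TopologicalSpace (TotalSpace F V)]
  [∀ p, AddCommGroup (V p)] [∀ p, Module ℝ (V p)] [∀ p, TopologicalSpace (V p)]
  [FiberBundle F V] [VectorBundle ℝ F V]

section VectorBundle

instance : Module C^∞⟮𝓘(ℝ, EM), M; ℝ⟯ Cₛ^∞⟮𝓘(ℝ, EM); F, V⟯ where
  one_smul u := by ext p; exact one_smul ℝ (u p)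
  mul_smul f g u := by ext p; exact mul_smul (f p) (g p) (u p)
  smul_zero f := by ext p; exact smul_zero (f p)
  smul_add f u v := by ext p; exact smul_add (f p) (u p) (v p)
  add_smul f g u := by ext p; exact add_smul (f p) (g p) (u p)
  zero_smul u := by ext p; exact zero_smul ℝ (u p)

instance : IsScalarTower ℝ C^∞⟮𝓘(ℝ, EM), M; ℝ⟯ Cₛ^∞⟮𝓘(ℝ, EM); F, V⟯ where
  smul_assoc c f u := by ext p; exact smul_assoc c (f p) (u p)

variable (EM F V) in
/-- Evaluation at `p` of smooth sections of a vector bundle. -/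
def secEval (p : M) : Cₛ^∞⟮𝓘(ℝ, EM); F, V⟯ →ₛₗ[evalAt EM p] V p where
  toFun u := u p
  map_add' _ _ := rfl
  map_smul' _ _ := rfl

theorem secEval_apply (p : M) (u : Cₛ^∞⟮𝓘(ℝ, EM); F, V⟯) : secEval EM F V p u = u p := rfl

theorem secEval_injective :
    Function.Injective fun (u : Cₛ^∞⟮𝓘(ℝ, EM); F, V⟯) p => secEval EM F V p u :=
  DFunLike.coe_injective

section LocalFrame

variable {ι : Type*} (b : Module.Basis ι ℝ F) (e : Trivialization F (π F V))
  [MemTrivializationAtlas e]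

theorem sum_localFrameCoeff_smul_localFrame [Fintype ι] [ContMDiffVectorBundle 1 F V 𝓘(ℝ, EM)]
    {p : M} (hp : p ∈ e.baseSet) (v : V p) :
    ∑ i, e.localFrameCoeff 𝓘(ℝ, EM) b i p v • e.localFrame b i p = v := by
  classical
  simpa using (e.eq_sum_localFrameCoeff_smul (I := 𝓘(ℝ, EM)) (s := Pi.single p v) hp).symm

theorem contMDiff_mul_localFrameCoeff [FiniteDimensional ℝ F]
    [ContMDiffVectorBundle ∞ F V 𝓘(ℝ, EM)] {φ : M → ℝ} (hφ : ContMDiff 𝓘(ℝ, EM) 𝓘(ℝ, ℝ) ∞ φ)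
    (hsupp : tsupport φ ⊆ e.baseSet) (i : ι) (u : Cₛ^∞⟮𝓘(ℝ, EM); F, V⟯) :
    ContMDiff 𝓘(ℝ, EM) 𝓘(ℝ, ℝ) ∞ fun p => φ p * e.localFrameCoeff 𝓘(ℝ, EM) b i p (u p) :=
  have : ContMDiffVectorBundle 1 F V 𝓘(ℝ, EM) := .of_le (n := ∞) (by simp)
  contMDiff_of_tsupport fun p hp => (hφ p).mul
    (contMDiffAt_localFrameCoeff b (hsupp (tsupport_mul_subset_left hp)) (u.contMDiff p) i)

end LocalFrame

theorem nonempty_cutoffFrame [FiniteDimensional ℝ EM] [T2Space M] [IsManifold 𝓘(ℝ, EM) ∞ M]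
    [FiniteDimensional ℝ F] [ContMDiffVectorBundle ∞ F V 𝓘(ℝ, EM)] (m : M) :
    Nonempty (CutoffFrame (secEval EM F V) m) := by
  have : ContMDiffVectorBundle 1 F V 𝓘(ℝ, EM) := .of_le (n := ∞) (by simp)
  let e := trivializationAt F V m
  let b := Module.finBasis ℝ F
  obtain ⟨φ, -, hφ⟩ := (SmoothBumpFunction.nhds_basis_tsupport (I := 𝓘(ℝ, EM)) m).mem_iff.1
    (e.open_baseSet.mem_nhds (FiberBundle.mem_baseSet_trivializationAt' m))
  let φ' : C^∞⟮𝓘(ℝ, EM), M; ℝ⟯ := ⟨φ, φ.contMDiff⟩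
  exact ⟨{
    ι := Fin (Module.finrank ℝ F)
    sec i := ⟨(φ : M → ℝ) • e.localFrame b i, ContMDiffOn.smul_section_of_tsupport
      φ.contMDiff.contMDiffOn e.open_baseSet hφ (e.contMDiffOn_localFrame_baseSet ∞ b i)⟩
    coord i p := φ p • e.localFrameCoeff 𝓘(ℝ, EM) b i p
    contMDiff_coord := contMDiff_mul_localFrameCoeff b e φ.contMDiff hφ
    cut := φ' * φ'
    cut_self := show φ m * φ m = 1 by simp
    sum_coord_smul_sec p v := by
      change ∑ i, (φ p * e.localFrameCoeff 𝓘(ℝ, EM) b i p v) • φ p • e.localFrame b i p =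
        (φ p * φ p) • v
      by_cases hp : p ∈ e.baseSet
      · conv_rhs => rw [← sum_localFrameCoeff_smul_localFrame (EM := EM) b e hp v]
        rw [Finset.smul_sum]
        exact Finset.sum_congr rfl fun i _ => by module
      · have hφp : φ p = 0 := image_eq_zero_of_notMem_tsupport fun h => hp (hφ h)
        simp [hφp] }⟩

end VectorBundle

section GaugeFiber

variable {p : M}

theorem gaugeFiber_ext {δ ε : GaugeFiber EM F V p} (hop : ∀ u, gaugeOp δ u = gaugeOp ε u)
    (hanchor : gaugeAnchor δ = gaugeAnchor ε) : δ = ε :=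
  Subtype.ext (Prod.ext (LinearMap.ext hop) hanchor)

theorem gaugeOp_smul (δ : GaugeFiber EM F V p) (f : C^∞⟮𝓘(ℝ, EM), M; ℝ⟯)
    (u : Cₛ^∞⟮𝓘(ℝ, EM); F, V⟯) :
    gaugeOp δ (f • u) = f p • gaugeOp δ u + dirDeriv (gaugeAnchor δ) f • u p :=
  δ.2 f u

variable (EM F V) in
/-- The operator underlying a fibre element, as a linear map. -/
def gaugeOpₗ (p : M) : GaugeFiber EM F V p →ₗ[ℝ] Cₛ^∞⟮𝓘(ℝ, EM); F, V⟯ →ₗ[ℝ] V p :=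
  LinearMap.fst ℝ _ _ ∘ₗ (GaugeFiber EM F V p).subtype

variable (EM F V) in
/-- The anchor of `𝔇E` as a linear map on a fibre. -/
def gaugeAnchorₗ (p : M) : GaugeFiber EM F V p →ₗ[ℝ] TangentSpace 𝓘(ℝ, EM) p :=
  LinearMap.snd ℝ _ _ ∘ₗ (GaugeFiber EM F V p).subtype

variable (EM F V) in
/-- The embedding `gl(E_p) → (𝔇E)_p` as a linear map. -/
def gaugeOfEndₗ (p : M) : (V p →ₗ[ℝ] V p) →ₗ[ℝ] GaugeFiber EM F V p where
  toFun := gaugeOfEnd EM F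
  map_add' _ _ := gaugeFiber_ext (fun _ => rfl) (add_zero (0 : EM)).symm
  map_smul' c _ := gaugeFiber_ext (fun _ => rfl) (smul_zero (A := EM) c).symm

namespace CutoffFrame

variable {m : M} (S : CutoffFrame (secEval EM F V) m)

/-- The rank one endomorphism `coord i ⊗ v` of `E_p` as an element of `(𝔇E)_p`. -/
def rankOne (i : S.ι) (p : M) : V p →ₗ[ℝ] GaugeFiber EM F V p :=
  gaugeOfEndₗ EM F V p ∘ₗ LinearMap.smulRightₗ (S.coord i p)

/-- The covariant derivative for which the frame is parallel, multiplied by the cutoff function. -/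
def flatOp (p : M) : TangentSpace 𝓘(ℝ, EM) p →ₗ[ℝ] Cₛ^∞⟮𝓘(ℝ, EM); F, V⟯ →ₗ[ℝ] V p :=
  LinearMap.mk₂ ℝ
    (fun x u => ∑ i, dirDeriv x (S.coeff i u) • S.sec i p - dirDeriv x S.cut • u p)
    (fun x y u => by
      simp only [map_add, LinearMap.add_apply, add_smul, Finset.sum_add_distrib]
      abel)
    (fun c x u => by
      simp only [map_smul, LinearMap.smul_apply, smul_assoc, smul_sub, Finset.smul_sum])
    (fun x u v => by
      simp only [map_add, add_smul, Finset.sum_add_distrib, ContMDiffSection.coe_add, Pi.add_apply,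
        smul_add]
      abel)
    (fun c x u => by
      simp only [LinearMap.map_smul_of_tower, smul_assoc, smul_sub, Finset.smul_sum,
        ContMDiffSection.coe_smul, Pi.smul_apply, smul_comm _ c])

theorem flatOp_apply (x : TangentSpace 𝓘(ℝ, EM) p) (u : Cₛ^∞⟮𝓘(ℝ, EM); F, V⟯) :
    S.flatOp p x u = ∑ i, dirDeriv x (S.coeff i u) • S.sec i p - dirDeriv x S.cut • u p := rfl

theorem flatOp_smul (x : TangentSpace 𝓘(ℝ, EM) p) (f : C^∞⟮𝓘(ℝ, EM), M; ℝ⟯)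
    (u : Cₛ^∞⟮𝓘(ℝ, EM); F, V⟯) :
    S.flatOp p x (f • u) = f p • S.flatOp p x u + dirDeriv (S.cut p • x) f • u p := by
  have hanchor : dirDeriv (S.cut p • x) f • u p =
      ∑ i, S.coeff i u p • dirDeriv x f • S.sec i p := by
    rw [map_smul, LinearMap.smul_apply, smul_assoc, smul_comm, ← secEval_apply,
      ← S.sum_coord_smul_sec, Finset.smul_sum]
    exact Finset.sum_congr rfl fun i _ => smul_comm _ _ _
  rw [hanchor]
  simp only [flatOp_apply, map_smul, smul_eq_mul, dirDeriv_mul, add_smul, mul_smul,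
    Finset.sum_add_distrib, smul_sub, Finset.smul_sum, smul_sec_apply]
  module

/-- The lift of tangent vectors to `(𝔇E)_p` given by `flatOp`, with anchor `cut p • x`. -/
def flatLift (p : M) : TangentSpace 𝓘(ℝ, EM) p →ₗ[ℝ] GaugeFiber EM F V p where
  toFun x := ⟨(S.flatOp p x, S.cut p • x), S.flatOp_smul x⟩
  map_add' x y := Subtype.ext (Prod.ext (map_add _ x y) (smul_add _ x y))
  map_smul' c x := Subtype.ext (Prod.ext (map_smul _ c x) (smul_comm _ c x))

theorem cut_smul_gaugeFiber (δ : GaugeFiber EM F V p) :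
    S.cut p • δ = ∑ i, S.rankOne i p (gaugeOp δ (S.sec i)) + S.flatLift p (gaugeAnchor δ) := by
  refine gaugeFiber_ext (fun u => ?_) ?_
  · change gaugeOpₗ EM F V p (S.cut p • δ) u = gaugeOpₗ EM F V p (_ + _) u
    have hcut := gaugeOp_smul δ S.cut u
    rw [← S.sum_coeff_smul_sec secEval_injective, map_sum] at hcut
    simp only [gaugeOp_smul, Finset.sum_add_distrib] at hcut
    simp only [map_smul, map_add, map_sum, LinearMap.smul_apply, LinearMap.add_apply,
      LinearMap.sum_apply]
    exact (eq_sub_of_add_eq hcut.symm).trans (add_sub_assoc _ _ _)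
  · change gaugeAnchorₗ EM F V p (S.cut p • δ) = gaugeAnchorₗ EM F V p (_ + _)
    have hrankOne (i : S.ι) (v : V p) : gaugeAnchorₗ EM F V p (S.rankOne i p v) = 0 := rfl
    simp only [map_smul, map_add, map_sum, hrankOne, Finset.sum_const_zero, zero_add]
    rfl

theorem eq_sum_rankOne_of_anchor_eq_zero {δ : GaugeFiber EM F V m} (hδ : gaugeAnchor δ = 0) :
    δ = ∑ i, S.rankOne i m (gaugeOp δ (S.sec i)) := by
  have h := S.cut_smul_gaugeFiber δ
  rwa [S.cut_self, one_smul, hδ, map_zero, add_zero] at h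

end CutoffFrame

end GaugeFiber

variable [IsManifold 𝓘(ℝ, EM) ∞ M]

section GaugeSec

instance : Module C^∞⟮𝓘(ℝ, EM), M; ℝ⟯ (GaugeSec EM F V) where
  one_smul d := Subtype.ext (funext fun p => one_smul ℝ (d.1 p))
  mul_smul f g d := Subtype.ext (funext fun p => mul_smul (f p) (g p) (d.1 p))
  smul_zero f := Subtype.ext (funext fun p => smul_zero (f p))
  smul_add f d r := Subtype.ext (funext fun p => smul_add (f p) (d.1 p) (r.1 p))
  add_smul f g d := Subtype.ext (funext fun p => add_smul (f p) (g p) (d.1 p))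
  zero_smul d := Subtype.ext (funext fun p => zero_smul ℝ (d.1 p))

variable (EM F V) in
/-- Evaluation at `p` of smooth sections of `𝔇E`. -/
def gaugeEval (p : M) : GaugeSec EM F V →ₛₗ[evalAt EM p] GaugeFiber EM F V p where
  toFun d := d.1 p
  map_add' _ _ := rfl
  map_smul' _ _ := rfl

theorem gaugeEval_injective :
    Function.Injective fun (d : GaugeSec EM F V) p => gaugeEval EM F V p d :=
  Subtype.val_injective

namespace CutoffFrame

variable {m : M} (S : CutoffFrame (secEval EM F V) m)

/-- The section `coord i ⊗ s` of `gl(E) ⊂ 𝔇E`. -/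
def rankOneSec (i : S.ι) (s : Cₛ^∞⟮𝓘(ℝ, EM); F, V⟯) : GaugeSec EM F V :=
  ⟨fun p => S.rankOne i p (s p), fun u => (S.coeff i u • s).contMDiff, (0 : GaugeSec EM F V).2.2⟩

/-- The section of `𝔇E` lifting a vector field, multiplied by the cutoff function. -/
def flatLiftSec (Y : Cₛ^∞⟮𝓘(ℝ, EM); EM, (TangentSpace 𝓘(ℝ, EM) : M → Type _)⟯) :
    GaugeSec EM F V :=
  ⟨fun p => S.flatLift p (Y p),
    fun u => (ContMDiff.sum_section fun i _ =>
      (contMDiff_mvfderiv_apply (S.coeff i u) Y.contMDiff).smul_section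
        (S.sec i).contMDiff).sub_section
      ((contMDiff_mvfderiv_apply S.cut Y.contMDiff).smul_section u.contMDiff),
    S.cut.contMDiff.smul_section Y.contMDiff⟩

/-- The cutoff frame of `𝔇E` obtained from cutoff frames of `E` and of `TM`. -/
def gauge (T : CutoffFrame (secEval EM EM (TangentSpace 𝓘(ℝ, EM) : M → Type _)) m) :
    CutoffFrame (gaugeEval EM F V) m where
  ι := (S.ι × S.ι) ⊕ T.ι
  sec := Sum.elim (fun ij => S.rankOneSec ij.1 (S.sec ij.2)) fun k => S.flatLiftSec (T.sec k)
  coord := Sum.elim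
    (fun ij p => T.cut p • S.coord ij.2 p ∘ₗ (gaugeOpₗ EM F V p).flip (S.sec ij.1))
    fun k p => S.cut p • T.coord k p ∘ₗ gaugeAnchorₗ EM F V p
  contMDiff_coord := by
    rintro (⟨i, j⟩ | k) d
    · exact T.cut.contMDiff.mul (S.contMDiff_coord j (act d (S.sec i)))
    · exact S.cut.contMDiff.mul (T.contMDiff_coord k ⟨_, d.2.2⟩)
  cut := T.cut * S.cut * S.cut
  cut_self := show T.cut m * S.cut m * S.cut m = 1 by
    rw [S.cut_self, T.cut_self, one_mul, one_mul]
  sum_coord_smul_sec p δ := by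
    have hend (i : S.ι) : ∑ j, (T.cut p * S.coord j p (gaugeOp δ (S.sec i))) •
        S.rankOne i p (S.sec j p) =
          (T.cut p * S.cut p) • S.rankOne i p (gaugeOp δ (S.sec i)) := by
      simp only [mul_smul, ← Finset.smul_sum]
      exact congrArg _ (S.sum_coord_smul_map (S.rankOne i p) _)
    have hlift : ∑ k, (S.cut p * T.coord k p (gaugeAnchor δ)) • S.flatLift p (T.sec k p) =
        (T.cut p * S.cut p) • S.flatLift p (gaugeAnchor δ) := by
      simp only [mul_comm (T.cut p), mul_smul, ← Finset.smul_sum]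
      exact congrArg _ (T.sum_coord_smul_map (S.flatLift p) _)
    rw [Fintype.sum_sum_type, Fintype.sum_prod_type]
    calc _ = ∑ i, ∑ j, (T.cut p * S.coord j p (gaugeOp δ (S.sec i))) •
            S.rankOne i p (S.sec j p) +
          ∑ k, (S.cut p * T.coord k p (gaugeAnchor δ)) • S.flatLift p (T.sec k p) := rfl
      _ = (T.cut p * S.cut p) • S.cut p • δ := by
        simp only [hend, hlift, ← Finset.smul_sum, ← smul_add, S.cut_smul_gaugeFiber]
      _ = _ := smul_smul _ _ _

end CutoffFrame

variable [FiniteDimensional ℝ EM] [T2Space M] [FiniteDimensional ℝ F]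
  [ContMDiffVectorBundle ∞ F V 𝓘(ℝ, EM)]

theorem nonempty_cutoffFrame_gauge (m : M) : Nonempty (CutoffFrame (gaugeEval EM F V) m) :=
  have ⟨S⟩ := nonempty_cutoffFrame (F := F) (V := V) m
  have ⟨T⟩ := nonempty_cutoffFrame (F := EM) (V := (TangentSpace 𝓘(ℝ, EM) : M → Type _)) m
  ⟨S.gauge T⟩

theorem exists_eq_gaugeOfEnd {m : M} {δ : GaugeFiber EM F V m} (hδ : gaugeAnchor δ = 0) :
    ∃ Φ : V m →ₗ[ℝ] V m, δ = gaugeOfEnd EM F Φ := by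
  obtain ⟨S⟩ := nonempty_cutoffFrame (EM := EM) (F := F) (V := V) m
  exact ⟨_, (S.eq_sum_rankOne_of_anchor_eq_zero hδ).trans
    (map_sum (gaugeOfEndₗ EM F V m) _ _).symm⟩

theorem exists_gaugeSec_eq_of_anchor_eq_zero {m : M} {δ : GaugeFiber EM F V m}
    (hδ : gaugeAnchor δ = 0) :
    ∃ r : GaugeSec EM F V, r.1 m = δ ∧ ∀ p, gaugeAnchor (r.1 p) = 0 := by
  obtain ⟨S⟩ := nonempty_cutoffFrame (EM := EM) (F := F) (V := V) m
  choose s hs using fun i => S.eval_surjective (gaugeOp δ (S.sec i))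
  refine ⟨∑ i, S.rankOneSec i (s i), ?_, fun p => ?_⟩
  · rw [S.eq_sum_rankOne_of_anchor_eq_zero hδ]
    simp only [← hs]
    exact map_sum (gaugeEval EM F V m) _ _
  · change gaugeAnchorₗ EM F V p (gaugeEval EM F V p _) = 0
    simp only [map_sum]
    exact Finset.sum_eq_zero fun i _ => rfl

theorem jetSec_ext {μ ν : JetSec EM F V} (h : ∀ r, pairing μ r = pairing ν r) : μ = ν := by
  refine Subtype.ext (funext fun m => Subtype.ext (LinearMap.ext fun δ => ?_))
  obtain ⟨S⟩ := nonempty_cutoffFrame_gauge (EM := EM) (F := F) (V := V) m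
  obtain ⟨r, rfl⟩ := S.eval_surjective δ
  exact DFunLike.congr_fun (h r) m

end GaugeSec

section Operations

variable (f : C^∞⟮𝓘(ℝ, EM), M; ℝ⟯) (c : ℝ) (u v : Cₛ^∞⟮𝓘(ℝ, EM); F, V⟯)
  (d r : GaugeSec EM F V) (μ ν : JetSec EM F V)

theorem act_add_right : act d (u + v) = act d u + act d v := by
  ext p; exact map_add (gaugeOp (d.1 p)) u v

theorem act_sub_right : act d (u - v) = act d u - act d v := by
  ext p; exact map_sub (gaugeOp (d.1 p)) u v

theorem act_const_smul_right : act d (c • u) = c • act d u := by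
  ext p; exact map_smul (gaugeOp (d.1 p)) c u

theorem act_add_left : act (d + r) u = act d u + act r u := rfl

theorem act_const_smul_left : act (c • d) u = c • act d u := rfl

theorem act_smul_left : act (f • d) u = f • act d u := rfl

theorem pairing_add_right : pairing μ (d + r) = pairing μ d + pairing μ r := by
  ext p; exact map_add (μ.1 p).1 _ _

theorem pairing_neg_right : pairing μ (-d) = -pairing μ d := by
  ext p; exact map_neg (μ.1 p).1 _

theorem pairing_const_smul_right : pairing μ (c • d) = c • pairing μ d := by
  ext p; exact map_smul (μ.1 p).1 _ _

theorem pairing_smul_right : pairing μ (f • d) = f • pairing μ d := by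
  ext p; exact map_smul (μ.1 p).1 _ _

theorem pairing_add_left : pairing (μ + ν) d = pairing μ d + pairing ν d := rfl

theorem pairing_const_smul_left : pairing (c • μ) d = c • pairing μ d := rfl

theorem pairing_smul_left : pairing (f • μ) d = f • pairing μ d := rfl

theorem pairing_jetD : pairing (jetD u) d = act d u := rfl

end Operations

section Bracket

variable (f : C^∞⟮𝓘(ℝ, EM), M; ℝ⟯) (c : ℝ) (d r t : GaugeSec EM F V)

theorem gaugeSec_ext {d r : GaugeSec EM F V} (hop : ∀ u, act d u = act r u)
    (hanchor : ∀ p, gaugeAnchor (d.1 p) = gaugeAnchor (r.1 p)) : d = r :=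
  Subtype.ext (funext fun p =>
    gaugeFiber_ext (fun u => DFunLike.congr_fun (hop u) p) (hanchor p))

theorem mdifferentiableAt_anchor (p : M) :
    MDifferentiableAt 𝓘(ℝ, EM) 𝓘(ℝ, EM).tangent
      (fun m => (⟨m, gaugeAnchor (d.1 m)⟩ : TangentBundle 𝓘(ℝ, EM) M)) p :=
  (d.2.2 p).mdifferentiableAt (by simp)

theorem minSmoothness_le_infty (n : ℕ) : minSmoothness ℝ n ≤ (∞ : ℕ∞ω) := by
  rw [minSmoothness_of_isRCLikeNormedField]
  exact WithTop.coe_le_coe.2 (le_top : (n : ℕ∞) ≤ ⊤)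

local instance : IsManifold 𝓘(ℝ, EM) (minSmoothness ℝ 2) M :=
  .of_le (minSmoothness_le_infty 2)

variable [FiniteDimensional ℝ EM]

local instance : CompleteSpace EM := FiniteDimensional.complete ℝ EM

theorem act_gaugeBracket (u : Cₛ^∞⟮𝓘(ℝ, EM); F, V⟯) :
    act (gaugeBracket d r) u = act d (act r u) - act r (act d u) := rfl

theorem gaugeBracket_swap : gaugeBracket d r = -gaugeBracket r d :=
  gaugeSec_ext (fun u => (neg_sub (act r (act d u)) (act d (act r u))).symm)
    fun _ => mlieBracket_swap_apply

theorem gaugeBracket_self : gaugeBracket d d = 0 :=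
  gaugeSec_ext (fun u => sub_self (act d (act d u)))
    fun p => congrFun mlieBracket_self p

theorem gaugeBracket_add_right :
    gaugeBracket d (r + t) = gaugeBracket d r + gaugeBracket d t := by
  refine gaugeSec_ext (fun u => ?_) fun p =>
    mlieBracket_add_right (mdifferentiableAt_anchor r p) (mdifferentiableAt_anchor t p)
  simp only [act_gaugeBracket, act_add_left, act_add_right]
  abel

theorem gaugeBracket_const_smul_right : gaugeBracket d (c • r) = c • gaugeBracket d r := by
  refine gaugeSec_ext (fun u => ?_) fun p =>
    mlieBracket_const_smul_right (mdifferentiableAt_anchor r p)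
  simp only [act_gaugeBracket, act_const_smul_left, act_const_smul_right, smul_sub]

theorem gaugeBracket_smul_right :
    gaugeBracket d (f • r) = f • gaugeBracket d r + anchorDeriv d f • r := by
  refine gaugeSec_ext (fun u => ?_) fun p =>
    (mlieBracket_smul_right f.mdifferentiableAt (mdifferentiableAt_anchor r p)).trans
      (add_comm _ _)
  simp only [act_gaugeBracket, act_add_left, act_smul_left, act_smul, smul_sub]
  abel

theorem gaugeBracket_add_left :
    gaugeBracket (d + r) t = gaugeBracket d t + gaugeBracket r t := by
  rw [gaugeBracket_swap, gaugeBracket_add_right, gaugeBracket_swap d, gaugeBracket_swap r]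
  exact neg_add (gaugeBracket t d) (gaugeBracket t r)

theorem gaugeBracket_const_smul_left : gaugeBracket (c • d) r = c • gaugeBracket d r := by
  rw [gaugeBracket_swap, gaugeBracket_const_smul_right, gaugeBracket_swap d]
  exact (smul_neg c (gaugeBracket r d)).symm

theorem pairing_gaugeBracket_smul_left (μ : JetSec EM F V) :
    pairing μ (gaugeBracket (f • d) r) =
      f • pairing μ (gaugeBracket d r) - anchorDeriv r f • pairing μ d := by
  rw [gaugeBracket_swap, gaugeBracket_smul_right, gaugeBracket_swap d]
  simp only [pairing_neg_right, pairing_add_right, pairing_smul_right, smul_neg]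
  abel

theorem gaugeBracket_leibniz :
    gaugeBracket d (gaugeBracket r t) =
      gaugeBracket (gaugeBracket d r) t + gaugeBracket r (gaugeBracket d t) := by
  have : IsManifold 𝓘(ℝ, EM) (minSmoothness ℝ 3) M := .of_le (minSmoothness_le_infty 3)
  refine gaugeSec_ext (fun u => ?_) fun p =>
    leibniz_identity_mlieBracket_apply ((d.2.2 p).of_le (minSmoothness_le_infty 2))
      ((r.2.2 p).of_le (minSmoothness_le_infty 2)) ((t.2.2 p).of_le (minSmoothness_le_infty 2))
  simp only [act_gaugeBracket, act_add_left, act_sub_right]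
  abel

theorem pairing_gaugeBracket_gaugeBracket (μ : JetSec EM F V) :
    pairing μ (gaugeBracket (gaugeBracket d r) t) =
      pairing μ (gaugeBracket d (gaugeBracket r t)) -
        pairing μ (gaugeBracket r (gaugeBracket d t)) := by
  rw [gaugeBracket_leibniz d, pairing_add_right, add_sub_cancel_right]

theorem anchor_gaugeBracket_eq_zero {r : GaugeSec EM F V} (hr : ∀ p, gaugeAnchor (r.1 p) = 0)
    (p : M) : gaugeAnchor ((gaugeBracket d r).1 p) = 0 := by
  change mlieBracket 𝓘(ℝ, EM) _ (fun p => gaugeAnchor (r.1 p)) p = 0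
  rw [funext hr]
  exact congrFun mlieBracket_zero_right p

theorem fst_dorfman (X Y : OmniSec EM F V) : (dorfman X Y).1 = gaugeBracket X.1 Y.1 := rfl

end Bracket

variable [FiniteDimensional ℝ EM] [T2Space M] [FiniteDimensional ℝ F]
  [ContMDiffVectorBundle ∞ F V 𝓘(ℝ, EM)]

section LieDerivative

variable (EM F V) in
/-- The identity section of `gl(E) ⊂ 𝔇E`. -/
def gaugeOne : GaugeSec EM F V :=
  ⟨fun _ => gaugeOfEnd EM F LinearMap.id, fun u => u.contMDiff, (0 : GaugeSec EM F V).2.2⟩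

theorem pairing_eq_act_of_anchor_eq_zero (μ : JetSec EM F V) {r : GaugeSec EM F V}
    (hr : ∀ p, gaugeAnchor (r.1 p) = 0) :
    pairing μ r = act r (pairing μ (gaugeOne EM F V)) := by
  ext p
  obtain ⟨Φ, hΦ⟩ := exists_eq_gaugeOfEnd (hr p)
  change (μ.1 p).1 (r.1 p) = gaugeOp (r.1 p) (pairing μ (gaugeOne EM F V))
  rw [hΦ]
  exact (μ.1 p).2 Φ

theorem exists_jetSec_pairing_eq
    (L : GaugeSec EM F V →ₗ[C^∞⟮𝓘(ℝ, EM), M; ℝ⟯] Cₛ^∞⟮𝓘(ℝ, EM); F, V⟯)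
    (w : Cₛ^∞⟮𝓘(ℝ, EM); F, V⟯)
    (hL : ∀ r : GaugeSec EM F V, (∀ p, gaugeAnchor (r.1 p) = 0) → L r = act r w) :
    ∃ ν : JetSec EM F V, ∀ r, pairing ν r = L r := by
  have hfiber (m : M) : ∃ ν : GaugeFiber EM F V m →ₗ[ℝ] V m, ∀ r, L r m = ν (r.1 m) :=
    have ⟨S⟩ := nonempty_cutoffFrame_gauge (EM := EM) (F := F) (V := V) m
    S.exists_eq_comp_eval gaugeEval_injective ((secEval EM F V m).comp L)
  choose ν hν using hfiber
  have hν_end (m : M) (Φ : V m →ₗ[ℝ] V m) : ν m (gaugeOfEnd EM F Φ) = Φ (w m) := by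
    obtain ⟨r, hr, hanchor⟩ := exists_gaugeSec_eq_of_anchor_eq_zero (δ := gaugeOfEnd EM F Φ) rfl
    rw [← hr, ← hν, hL r hanchor]
    exact congrArg (gaugeOp · w) hr
  have hjet (m : M) : ν m ∈ JetFiber EM F V m := fun Φ => by rw [hν_end, hν_end]; rfl
  refine ⟨⟨fun m => ⟨ν m, hjet m⟩, fun r => ?_⟩, fun r => ?_⟩
  · simpa only [← hν] using (L r).contMDiff
  · ext m
    exact (hν m r).symm

/-- The `C^∞(M)`-linear map `r ↦ d⟨μ, r⟩ - ⟨μ, [d, r]⟩`, whose representing section of `𝔍E` is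
the Lie derivative `𝔏_d μ`. -/
def lieOperator (d : GaugeSec EM F V) (μ : JetSec EM F V) :
    GaugeSec EM F V →ₗ[C^∞⟮𝓘(ℝ, EM), M; ℝ⟯] Cₛ^∞⟮𝓘(ℝ, EM); F, V⟯ where
  toFun r := act d (pairing μ r) - pairing μ (gaugeBracket d r)
  map_add' r t := by
    simp only [pairing_add_right, gaugeBracket_add_right, act_add_right]
    abel
  map_smul' f r := by
    simp only [pairing_smul_right, gaugeBracket_smul_right, act_smul, pairing_add_right, smul_sub,
      RingHom.id_apply]
    abel

theorem exists_isLieDerivative (d : GaugeSec EM F V) (μ : JetSec EM F V) :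
    ∃ ν, IsLieDerivative d μ ν := by
  refine exists_jetSec_pairing_eq (lieOperator d μ) (act d (pairing μ (gaugeOne EM F V)))
    fun r hr => ?_
  change act d (pairing μ r) - pairing μ (gaugeBracket d r) = _
  rw [pairing_eq_act_of_anchor_eq_zero μ hr,
    pairing_eq_act_of_anchor_eq_zero μ (anchor_gaugeBracket_eq_zero d hr), act_gaugeBracket,
    sub_sub_cancel]

theorem isLieDerivative_lieDerivative (d : GaugeSec EM F V) (μ : JetSec EM F V) :
    IsLieDerivative d μ (lieDerivative d μ) := by
  have h := exists_isLieDerivative d μ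
  rw [lieDerivative, dif_pos h]
  exact h.choose_spec

theorem IsLieDerivative.unique {d : GaugeSec EM F V} {μ ν ν' : JetSec EM F V}
    (hν : IsLieDerivative d μ ν) (hν' : IsLieDerivative d μ ν') : ν = ν' :=
  jetSec_ext fun r => (hν r).trans (hν' r).symm

end LieDerivative

section Dorfman

variable (X Y Z : OmniSec EM F V)

theorem omniSec_ext {X Y : OmniSec EM F V} (hfst : X.1 = Y.1)
    (hsnd : ∀ r, pairing X.2 r = pairing Y.2 r) : X = Y :=
  Prod.ext hfst (jetSec_ext hsnd)

theorem pairing_dorfman (s : GaugeSec EM F V) :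
    pairing (dorfman X Y).2 s =
      act X.1 (pairing Y.2 s) - pairing Y.2 (gaugeBracket X.1 s) -
        (act Y.1 (pairing X.2 s) - pairing X.2 (gaugeBracket Y.1 s)) +
        act s (pairing X.2 Y.1) := by
  rw [← isLieDerivative_lieDerivative X.1 Y.2, ← isLieDerivative_lieDerivative Y.1 X.2]
  rfl

theorem dorfman_add_left : dorfman (X + Y) Z = dorfman X Z + dorfman Y Z :=
  omniSec_ext (gaugeBracket_add_left _ _ _) fun s => by
    simp only [pairing_dorfman, Prod.fst_add, Prod.snd_add, pairing_add_left, pairing_add_right,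
      act_add_left, act_add_right, gaugeBracket_add_left]
    abel

theorem dorfman_add_right : dorfman X (Y + Z) = dorfman X Y + dorfman X Z :=
  omniSec_ext (gaugeBracket_add_right _ _ _) fun s => by
    simp only [pairing_dorfman, Prod.fst_add, Prod.snd_add, pairing_add_left, pairing_add_right,
      act_add_left, act_add_right, gaugeBracket_add_left]
    abel

theorem dorfman_const_smul_left (c : ℝ) : dorfman (c • X) Y = c • dorfman X Y :=
  omniSec_ext (gaugeBracket_const_smul_left _ _ _) fun s => by
    simp only [pairing_dorfman, Prod.smul_fst, Prod.smul_snd, pairing_const_smul_left,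
      pairing_const_smul_right, act_const_smul_left, act_const_smul_right,
      gaugeBracket_const_smul_left, smul_sub, smul_add]

theorem dorfman_const_smul_right (c : ℝ) : dorfman X (c • Y) = c • dorfman X Y :=
  omniSec_ext (gaugeBracket_const_smul_right _ _ _) fun s => by
    simp only [pairing_dorfman, Prod.smul_fst, Prod.smul_snd, pairing_const_smul_left,
      pairing_const_smul_right, act_const_smul_left, act_const_smul_right,
      gaugeBracket_const_smul_left, smul_sub, smul_add]

theorem dorfman_leibniz :
    dorfman X (dorfman Y Z) = dorfman (dorfman X Y) Z + dorfman Y (dorfman X Z) :=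
  omniSec_ext (gaugeBracket_leibniz _ _ _) fun s => by
    simp only [pairing_dorfman, Prod.snd_add, pairing_add_left, fst_dorfman, act_add_right,
      act_sub_right, act_gaugeBracket, pairing_gaugeBracket_gaugeBracket]
    abel

theorem isLeibnizAlgebra_dorfman :
    IsLeibnizAlgebra (dorfman : OmniSec EM F V → OmniSec EM F V → OmniSec EM F V) where
  add_left := dorfman_add_left
  smul_left c X Y := dorfman_const_smul_left X Y c
  add_right := dorfman_add_right
  smul_right c X Y := dorfman_const_smul_right X Y c
  leibniz := dorfman_leibniz

theorem dorfman_smul_right (f : C^∞⟮𝓘(ℝ, EM), M; ℝ⟯) :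
    dorfman X (f • Y) = f • dorfman X Y + anchorDeriv (rho X) f • Y := by
  refine omniSec_ext (gaugeBracket_smul_right _ _ _) fun s => ?_
  simp only [pairing_dorfman, Prod.smul_fst, Prod.smul_snd, Prod.snd_add, pairing_add_left,
    pairing_smul_left, pairing_smul_right, act_smul_left, act_smul,
    pairing_gaugeBracket_smul_left, smul_add, smul_sub, rho]
  abel

theorem dorfman_self : dorfman X X = ((0 : GaugeSec EM F V), jetD (omniPairing X X)) := by
  refine omniSec_ext (gaugeBracket_self _) fun s => ?_
  simp only [pairing_dorfman, pairing_jetD, omniPairing, act_const_smul_right, act_add_right]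
  module

theorem act_omniPairing :
    act (rho X) (omniPairing Y Z) =
      omniPairing (dorfman X Y) Z + omniPairing Y (dorfman X Z) := by
  simp only [omniPairing, pairing_dorfman, fst_dorfman, act_const_smul_right, act_add_right, rho,
    gaugeBracket_swap Z.1 Y.1, pairing_neg_right]
  module

end Dorfman

end

end OmniLie

theorem mainTheorem4
    {EM : Type*} [NormedAddCommGroup EM] [NormedSpace ℝ EM] [FiniteDimensional ℝ EM]
    {M : Type*} [TopologicalSpace M] [T2Space M] [ChartedSpace EM M] [IsManifold 𝓘(ℝ, EM) ∞ M]
    {F : Type*} [NormedAddCommGroup F] [NormedSpace ℝ F] [FiniteDimensional ℝ F]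
    {V : M → Type*} [TopologicalSpace (TotalSpace F V)]
    [∀ m, AddCommGroup (V m)] [∀ m, Module ℝ (V m)] [∀ m, TopologicalSpace (V m)]
    [FiberBundle F V] [VectorBundle ℝ F V] [ContMDiffVectorBundle ∞ F V 𝓘(ℝ, EM)] :
    -- the Lie derivative entering the bracket is well defined, with values in `Γ(𝔍E)`
    (∀ (d : OmniLie.GaugeSec EM F V) (μ : OmniLie.JetSec EM F V),
      OmniLie.IsLieDerivative d μ (OmniLie.lieDerivative d μ) ∧
        ∀ ν, OmniLie.IsLieDerivative d μ ν → ν = OmniLie.lieDerivative d μ) ∧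
    OmniLie.IsLeibnizAlgebra
      (OmniLie.dorfman : OmniLie.OmniSec EM F V → OmniLie.OmniSec EM F V →
        OmniLie.OmniSec EM F V) ∧
    (∀ X Y : OmniLie.OmniSec EM F V,
      OmniLie.rho (OmniLie.dorfman X Y) =
        OmniLie.gaugeBracket (OmniLie.rho X) (OmniLie.rho Y)) ∧
    (∀ (X Y : OmniLie.OmniSec EM F V) (f : C^∞⟮𝓘(ℝ, EM), M; ℝ⟯),
      OmniLie.dorfman X (f • Y) =
        f • OmniLie.dorfman X Y + OmniLie.anchorDeriv (OmniLie.rho X) f • Y) ∧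
    (∀ X : OmniLie.OmniSec EM F V,
      OmniLie.dorfman X X =
        ((0 : OmniLie.GaugeSec EM F V), OmniLie.jetD (OmniLie.omniPairing X X))) ∧
    (∀ X Y Z : OmniLie.OmniSec EM F V,
      OmniLie.act (OmniLie.rho X) (OmniLie.omniPairing Y Z) =
        OmniLie.omniPairing (OmniLie.dorfman X Y) Z +
          OmniLie.omniPairing Y (OmniLie.dorfman X Z)) := by
  exact ⟨fun d μ => ⟨OmniLie.isLieDerivative_lieDerivative d μ,
      fun _ hν => hν.unique (OmniLie.isLieDerivative_lieDerivative d μ)⟩,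
    OmniLie.isLeibnizAlgebra_dorfman, fun _ _ => rfl, OmniLie.dorfman_smul_right,
    OmniLie.dorfman_self, OmniLie.act_omniPairing⟩
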